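/- Let $\mathfrak C=\{0,1\}^{\mathbb N}$ be the Cantor set. A finite set $A$ of finite binary words is a dyadic partition set if $\mathfrak C=\bigsqcup_{w\in A}w\mathfrak C$, and Thompson's group $V$ is the group of all homeomorphisms $\gamma$ of $\mathfrak C$ for which there are dyadic partition sets $A,B$ and a bijection $f\colon A\to B$ with $\gamma(w\xi)=f(w)\xi$ for all $w\in A$, $\xi\in\mathfrak C$. Let $X_0\in V$ be given by $00\xi\mapsto 0\xi$, $01\xi\mapsto 10\xi$, $1\xi\mapsto 11\xi$. Let $n\ge 1$ be an integer, $X_n=\{0,1\}^n$, and let $a_n,b_n,c_n,d_n\in\operatorname{Sym}(X_n)$ be the permutations induced by the generators $a,b,c,d$ of the first Grigorchuk group, i.e. by the maps on finite binary words that fix the empty word and satisfy $a(xw)=(1-x)w$, $b(0w)=0\,a(w)$, $b(1w)=1\,c(w)$, $c(0w)=0\,a(w)$, $c(1w)=1\,d(w)$, $d(0w)=0w$, $d(1w)=1\,b(w)$. Put $\rho_n=1^n$, $\eta_n=1^{n-1}0$, $\theta_n=01^{n-1}$ and $Y_n=X_n\times\{1,2,3,4\}$, and let $\mathfrak C_{Y_n}=\bigsqcup_{y\in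 Y_n}\mathfrak C_y$ be the disjoint union of $4\cdot 2^n$ copies of $\mathfrak C$ indexed by $Y_n$. Let $T_n$ be the set of the following homeomorphisms of $\mathfrak C_{Y_n}$: 1. for each $g\in\{a_n,b_n,c_n,d_n\}$, the homeomorphism that maps $\mathfrak C_{(x,i)}$ to $\mathfrak C_{(g(x),i)}$ for all $(x,i)\in Y_n$ and leaves the Cantor coordinate unchanged; 2. for each $\sigma\in\operatorname{Sym}(4)$, the homeomorphism that maps $\mathfrak C_{(\eta_n,i)}$ to $\mathfrak C_{(\eta_n,\sigma(i))}$ for $1\le i\le 4$, leaves the Cantor coordinate unchanged, and is the identity elsewhere; 3. the homeomorphism $\tau_n$ that exchanges $\mathfrak C_{(\rho_n,1)}$ and $\mathfrak C_{(\theta_n,1)}$, leaves the Cantor coordinate unchanged, and is the identity elsewhere; 4. the homeomorphism $X_0^{(n)}$ that acts as $X_0$ on $\mathfrak C_{(\rho_n,2)}\sqcup\mathfrak C_{(\rho_n,3)}$, identified with $\mathfrak C$ by sending the point $\xi$ of $\mathfrak C_{(\rho_n,i)}$ to $(i-2)\xi$, and as the identity elsewhere; and the homeomorphism $X_1^{(n)}$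 that acts as $X_0$ on $\mathfrak C_{(\rho_n,4)}=\mathfrak C$ and as the identity elsewhere. Then for every $n\ge 1$ the group $W_n=\langle T_n\rangle$ of homeomorphisms of $\mathfrak C_{Y_n}$ is isomorphic to Thompson's group $V$. -/

import Mathlib

namespace ThompsonW

/-! ## The Cantor set and Thompson's group `V` -/

/-- The standard Cantor set `{0,1}^ℕ` (product topology); `false` is the letter `0` and `true`
is the letter `1`. -/
abbrev Cantor : Type := ℕ → Bool

/-- The sequence `b ξ`. -/
def cons (b : Bool) (ξ : Cantor) : Cantor
  | 0 => b
  | i + 1 => ξ i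

/-- The sequence `ξ` without its first letter. -/
def tail (ξ : Cantor) : Cantor := fun i => ξ (i + 1)

/-- The sequence `w ξ`, for a finite binary word `w`. -/
def prepend : List Bool → Cantor → Cantor
  | [], ξ => ξ
  | b :: w, ξ => cons b (prepend w ξ)

/-- The cylinder `w ℭ`. -/
def cylinder (w : List Bool) : Set Cantor := Set.range (prepend w)

/-- The `n`-th level `X_n = {0,1}^n` of the binary tree `{0,1}*`. -/
abbrev Level (n : ℕ) : Type := {w : List Bool // w.length = n}

/-- A finite set `A` of words is a dyadic partition set if the Cantor set is the disjoint union of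
the cylinders `w ℭ`, `w ∈ A`. -/
def IsDyadicPartition (A : Finset (List Bool)) : Prop :=
  (⋃ w ∈ A, cylinder w) = Set.univ ∧ (A : Set (List Bool)).PairwiseDisjoint cylinder

/-- `γ (w ξ) = f (w) ξ` for a bijection `f : A → B` between two dyadic partition sets. -/
def IsDyadic (γ : Cantor ≃ₜ Cantor) : Prop :=
  ∃ A B : Finset (List Bool), IsDyadicPartition A ∧ IsDyadicPartition B ∧
    ∃ f : A ≃ B, ∀ (w : A) (ξ : Cantor), γ (prepend w ξ) = prepend (f w) ξ

@[simp] theorem cons_zero (b : Bool) (ξ : Cantor) : cons b ξ 0 = b := rfl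

@[simp] theorem cons_succ (b : Bool) (ξ : Cantor) (i : ℕ) : cons b ξ (i + 1) = ξ i := rfl

@[simp] theorem tail_cons (b : Bool) (ξ : Cantor) : tail (cons b ξ) = ξ := rfl

theorem cons_head_tail (ξ : Cantor) : cons (ξ 0) (tail ξ) = ξ := by
  funext i
  cases i <;> rfl

theorem continuous_cons (b : Bool) : Continuous (cons b) := by
  refine continuous_pi fun i => ?_
  cases i with
  | zero => exact continuous_const
  | succ i => exact continuous_apply i

theorem continuous_tail : Continuous tail :=
  continuous_pi fun i => continuous_apply (i + 1)

theorem prepend_append (u v : List Bool) (ξ : Cantor) :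
    prepend (u ++ v) ξ = prepend u (prepend v ξ) := by
  induction u with
  | nil => rfl
  | cons b u ih => simp [prepend, ih]

theorem prepend_injective (w : List Bool) : Function.Injective (prepend w) := by
  induction w with
  | nil => exact fun _ _ h => h
  | cons b w ih => exact fun ξ ζ h => ih (congrArg tail h)

theorem exists_prepend (n : ℕ) (ξ : Cantor) :
    ∃ (w : List Bool) (ζ : Cantor), w.length = n ∧ ξ = prepend w ζ := by
  induction n generalizing ξ with
  | zero => exact ⟨[], ξ, rfl, rfl⟩
  | succ n ih =>
    obtain ⟨w, ζ, hw, h⟩ := ih (tail ξ)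
    refine ⟨ξ 0 :: w, ζ, by simp [hw], ?_⟩
    rw [prepend, ← h, cons_head_tail]

/-- Two words with a common infinite extension are comparable. -/
theorem exists_append {u v : List Bool} {ξ ζ : Cantor} (hl : u.length ≤ v.length)
    (h : prepend u ξ = prepend v ζ) : ∃ s, v = u ++ s := by
  induction u generalizing v with
  | nil => exact ⟨v, rfl⟩
  | cons b u ih =>
    cases v with
    | nil => simp at hl
    | cons b' v =>
      obtain ⟨s, hs⟩ := ih (v := v) (by simpa using hl) (congrArg tail h)
      have hb : b = b' := congrFun h 0
      exact ⟨s, by simp [hs, hb]⟩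

/-- A homeomorphism is dyadic iff it replaces prefixes on all cylinders of some fixed depth. -/
theorem isDyadic_iff (γ : Cantor ≃ₜ Cantor) :
    IsDyadic γ ↔ ∃ N : ℕ, ∀ w : List Bool, N ≤ w.length →
      ∃ v : List Bool, ∀ ξ, γ (prepend w ξ) = prepend v ξ := by
  constructor
  · rintro ⟨A, B, hA, -, f, hf⟩
    refine ⟨A.sup List.length, fun w hw => ?_⟩
    have hmem : prepend w (fun _ => false) ∈ ⋃ u ∈ A, cylinder u := by rw [hA.1]; trivial
    simp only [Set.mem_iUnion] at hmem
    obtain ⟨u, hu, ζ, hζ⟩ := hmem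
    obtain ⟨s, rfl⟩ := exists_append ((Finset.le_sup (f := List.length) hu).trans hw) hζ
    refine ⟨(f ⟨u, hu⟩ : List Bool) ++ s, fun ξ => ?_⟩
    rw [prepend_append, prepend_append]
    exact hf ⟨u, hu⟩ _
  · rintro ⟨N, hN⟩
    have : Fintype (Level N) := inferInstanceAs (Fintype (List.Vector Bool N))
    have hN' : ∀ w : Level N, ∃ v : List Bool, ∀ ξ,
        γ (prepend w.1 ξ) = prepend v ξ := fun w => hN w.1 w.2.ge
    choose f hf using hN'
    have key : ∀ {w w' : Level N} {ξ ζ : Cantor},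
        prepend (f w) ξ = prepend (f w') ζ → w = w' := by
      intro w w' ξ ζ h
      rw [← hf, ← hf] at h
      obtain ⟨s, hs⟩ := exists_append (by rw [w.2, w'.2]) (γ.injective h)
      have hl := congrArg List.length hs
      rw [List.length_append, w.2, w'.2] at hl
      have : s = [] := List.length_eq_zero_iff.mp (by omega)
      exact Subtype.ext (by rw [hs, this, List.append_nil])
    have finj : Function.Injective f := fun w w' h =>
      key (ξ := fun _ => false) (ζ := fun _ => false) (by rw [h])
    have vinj : Function.Injective (Subtype.val : Level N → List Bool) :=
      Subtype.val_injective
    let A : Finset (List Bool) := Finset.univ.map ⟨_, vinj⟩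
    let B : Finset (List Bool) := Finset.univ.map ⟨f, finj⟩
    have hmA : ∀ w, w ∈ A ↔ w ∈ Set.range (Subtype.val : Level N → List Bool) := by
      simp [A]
    have hmB : ∀ w, w ∈ B ↔ w ∈ Set.range f := by simp [B]
    let eA := (Equiv.ofInjective _ vinj).trans (Equiv.subtypeEquivRight fun w => (hmA w).symm)
    let eB := (Equiv.ofInjective _ finj).trans (Equiv.subtypeEquivRight fun w => (hmB w).symm)
    refine ⟨A, B, ⟨?_, ?_⟩, ⟨?_, ?_⟩, eA.symm.trans eB, ?_⟩
    · refine Set.eq_univ_of_forall fun ξ => ?_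
      obtain ⟨w, ζ, hw, rfl⟩ := exists_prepend N ξ
      exact Set.mem_biUnion ((hmA w).2 ⟨⟨w, hw⟩, rfl⟩) ⟨ζ, rfl⟩
    · intro u hu v hv huv
      obtain ⟨u, rfl⟩ := (hmA _).1 hu
      obtain ⟨v, rfl⟩ := (hmA _).1 hv
      refine Set.disjoint_left.2 ?_
      rintro _ ⟨ξ, rfl⟩ ⟨ζ, h⟩
      refine huv (congrArg Subtype.val (key (w := u) (w' := v) (ξ := ξ) (ζ := ζ) ?_))
      rw [← hf, ← hf, h]
    · refine Set.eq_univ_of_forall fun ξ => ?_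
      obtain ⟨w, ζ, hw, h⟩ := exists_prepend N (γ.symm ξ)
      refine Set.mem_biUnion ((hmB _).2 ⟨⟨w, hw⟩, rfl⟩) ⟨ζ, ?_⟩
      rw [← hf, ← h, γ.apply_symm_apply]
    · intro u hu v hv huv
      obtain ⟨u, rfl⟩ := (hmB _).1 hu
      obtain ⟨v, rfl⟩ := (hmB _).1 hv
      refine Set.disjoint_left.2 ?_
      rintro _ ⟨ξ, rfl⟩ ⟨ζ, h⟩
      exact huv (congrArg f (key h.symm))
    · intro w ξ
      obtain ⟨w, rfl⟩ := eA.surjective w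
      simp only [Equiv.trans_apply, Equiv.symm_apply_apply]
      exact hf w ξ

/-- Thompson's group `V`: the group of all dyadic homeomorphisms of the Cantor set. -/
def thompsonV : Subgroup (Cantor ≃ₜ Cantor) where
  carrier := {γ | IsDyadic γ}
  one_mem' := (isDyadic_iff 1).2 ⟨0, fun w _ => ⟨w, fun _ => rfl⟩⟩
  mul_mem' := by
    intro γ δ hγ hδ
    obtain ⟨M, hM⟩ := (isDyadic_iff γ).1 hγ
    obtain ⟨N, hN⟩ := (isDyadic_iff δ).1 hδ
    refine (isDyadic_iff (γ * δ)).2 ⟨N + M, fun w hw => ?_⟩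
    obtain ⟨v, hv⟩ := hN (w.take N) (by rw [List.length_take]; omega)
    obtain ⟨u, hu⟩ := hM (v ++ w.drop N) (by rw [List.length_append, List.length_drop]; omega)
    refine ⟨u, fun ξ => ?_⟩
    rw [← hu, prepend_append, ← hv, ← prepend_append, List.take_append_drop]
    rfl
  inv_mem' := by
    rintro γ ⟨A, B, hA, hB, f, hf⟩
    refine ⟨B, A, hB, hA, f.symm, fun w ξ => ?_⟩
    refine γ.injective ?_
    rw [hf, f.apply_symm_apply]
    exact γ.apply_symm_apply _

/-! ## The standard generator `X₀` of Thompson's group `F` -/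

/-- `00ξ ↦ 0ξ`, `01ξ ↦ 10ξ`, `1ξ ↦ 11ξ`. -/
def x0Fun (ξ : Cantor) : Cantor :=
  if ξ 0 = true then cons true (cons true (tail ξ))
  else if ξ 1 = true then cons true (cons false (tail (tail ξ)))
  else cons false (tail (tail ξ))

/-- `0ξ ↦ 00ξ`, `10ξ ↦ 01ξ`, `11ξ ↦ 1ξ`. -/
def x0Inv (ξ : Cantor) : Cantor :=
  if ξ 0 = true then
    if ξ 1 = true then cons true (tail (tail ξ)) else cons false (cons true (tail (tail ξ)))
  else cons false (cons false (tail ξ))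

theorem continuous_ite_coord (i : ℕ) {f g : Cantor → Cantor} (hf : Continuous f)
    (hg : Continuous g) : Continuous fun ξ : Cantor => if ξ i = true then f ξ else g ξ := by
  refine Continuous.if (fun ξ hξ => ?_) hf hg
  have hc : IsClopen {ξ : Cantor | ξ i = true} :=
    (isClopen_discrete {true}).preimage (continuous_apply i)
  rw [hc.frontier_eq] at hξ
  exact hξ.elim

theorem continuous_x0Fun : Continuous x0Fun :=
  continuous_ite_coord 0
    ((continuous_cons _).comp ((continuous_cons _).comp continuous_tail))
    (continuous_ite_coord 1
      ((continuous_cons _).comp ((continuous_cons _).comp (continuous_tail.comp continuous_tail)))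
      ((continuous_cons _).comp (continuous_tail.comp continuous_tail)))

theorem continuous_x0Inv : Continuous x0Inv :=
  continuous_ite_coord 0
    (continuous_ite_coord 1
      ((continuous_cons _).comp (continuous_tail.comp continuous_tail))
      ((continuous_cons _).comp ((continuous_cons _).comp (continuous_tail.comp continuous_tail))))
    ((continuous_cons _).comp ((continuous_cons _).comp continuous_tail))

/-- The standard generator `X₀` of Thompson's group `F`. -/
def x0 : Cantor ≃ₜ Cantor where
  toFun := x0Fun
  invFun := x0Inv
  left_inv ξ := by
    by_cases h0 : ξ 0 = true <;> by_cases h1 : ξ 1 = true <;> funext i <;>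
      rcases i with _ | _ | i <;> simp_all [x0Fun, x0Inv, cons, tail]
  right_inv ξ := by
    by_cases h0 : ξ 0 = true <;> by_cases h1 : ξ 1 = true <;> funext i <;>
      rcases i with _ | _ | i <;> simp_all [x0Fun, x0Inv, cons, tail]
  continuous_toFun := continuous_x0Fun
  continuous_invFun := continuous_x0Inv

/-! ## Homeomorphisms of a disjoint union of Cantor sets -/

/-- The disjoint union of copies of the Cantor set indexed by `Z`, with its disjoint union
topology; the points are the pairs `⟨z, ξ⟩`. -/
abbrev CantorUnion (Z : Type) : Type := Σ _ : Z, Cantor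

theorem continuous_mk {Z : Type} (z : Z) : Continuous fun ξ => (⟨z, ξ⟩ : CantorUnion Z) :=
  continuous_sigmaMk (σ := fun _ : Z => Cantor) (i := z)

/-- The homeomorphism `⟨z, ξ⟩ ↦ ⟨σ z, ξ⟩` permuting the copies of the Cantor set. -/
def permute {Z : Type} (σ : Equiv.Perm Z) : CantorUnion Z ≃ₜ CantorUnion Z where
  toFun p := ⟨σ p.1, p.2⟩
  invFun p := ⟨σ.symm p.1, p.2⟩
  left_inv p := by simp
  right_inv p := by simp
  continuous_toFun := continuous_sigma fun z => continuous_mk (σ z)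
  continuous_invFun := continuous_sigma fun z => continuous_mk (σ.symm z)

/-- The homeomorphism acting as `γ` on the copy indexed by `z` and trivially elsewhere. -/
def onCopy {Z : Type} [DecidableEq Z] (z : Z) (γ : Cantor ≃ₜ Cantor) :
    CantorUnion Z ≃ₜ CantorUnion Z where
  toFun p := if p.1 = z then ⟨p.1, γ p.2⟩ else p
  invFun p := if p.1 = z then ⟨p.1, γ.symm p.2⟩ else p
  left_inv := by rintro ⟨y, ξ⟩; by_cases h : y = z <;> simp [h]
  right_inv := by rintro ⟨y, ξ⟩; by_cases h : y = z <;> simp [h]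
  continuous_toFun := continuous_sigma fun y => by
    by_cases h : y = z
    · simpa [h] using (continuous_mk z).comp' γ.continuous
    · simpa [h] using continuous_mk y
  continuous_invFun := continuous_sigma fun y => by
    by_cases h : y = z
    · simpa [h] using (continuous_mk z).comp' γ.symm.continuous
    · simpa [h] using continuous_mk y

/-- The inverse of the identification `⟨z₀, ξ⟩ ↦ 0ξ`, `⟨z₁, ξ⟩ ↦ 1ξ` of the union of the
copies indexed by `z₀` and `z₁` with the Cantor set. -/
def split {Z : Type} (z₀ z₁ : Z) (ξ : Cantor) : CantorUnion Z :=
  if ξ 0 = true then ⟨z₁, tail ξ⟩ else ⟨z₀, tail ξ⟩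

theorem continuous_split {Z : Type} (z₀ z₁ : Z) : Continuous (split z₀ z₁) := by
  refine Continuous.if (fun ξ hξ => ?_) ((continuous_mk z₁).comp continuous_tail)
    ((continuous_mk z₀).comp continuous_tail)
  have hc : IsClopen {ξ : Cantor | ξ 0 = true} :=
    (isClopen_discrete {true}).preimage (continuous_apply 0)
  rw [hc.frontier_eq] at hξ
  exact hξ.elim

/-- The self-map acting as `γ` on the union of the copies indexed by `z₀` and `z₁`, identified
with the Cantor set via `⟨z₀, ξ⟩ ↦ 0ξ`, `⟨z₁, ξ⟩ ↦ 1ξ`, and trivially elsewhere. -/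
def onPairFun {Z : Type} [DecidableEq Z] (z₀ z₁ : Z) (γ : Cantor → Cantor)
    (p : CantorUnion Z) : CantorUnion Z :=
  if p.1 = z₀ then split z₀ z₁ (γ (cons false p.2))
  else if p.1 = z₁ then split z₀ z₁ (γ (cons true p.2))
  else p

theorem onPairFun_split {Z : Type} [DecidableEq Z] {z₀ z₁ : Z} (h : z₀ ≠ z₁)
    (γ : Cantor → Cantor) (ξ : Cantor) :
    onPairFun z₀ z₁ γ (split z₀ z₁ ξ) = split z₀ z₁ (γ ξ) := by
  have hξ := cons_head_tail ξ
  by_cases h0 : ξ 0 = true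
  · rw [h0] at hξ
    simp [onPairFun, split, h0, h.symm, hξ]
  · rw [Bool.not_eq_true] at h0
    rw [h0] at hξ
    simp [onPairFun, split, h0, hξ]

theorem onPairFun_onPairFun {Z : Type} [DecidableEq Z] {z₀ z₁ : Z} (h : z₀ ≠ z₁)
    (γ δ : Cantor → Cantor) (hγδ : ∀ ξ, γ (δ ξ) = ξ) (p : CantorUnion Z) :
    onPairFun z₀ z₁ γ (onPairFun z₀ z₁ δ p) = p := by
  obtain ⟨z, ξ⟩ := p
  by_cases h0 : z = z₀
  · subst h0
    have : onPairFun z z₁ δ ⟨z, ξ⟩ = split z z₁ (δ (cons false ξ)) := by simp [onPairFun]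
    rw [this, onPairFun_split h, hγδ]
    simp [split]
  · by_cases h1 : z = z₁
    · subst h1
      have : onPairFun z₀ z δ ⟨z, ξ⟩ = split z₀ z (δ (cons true ξ)) := by
        simp [onPairFun, h.symm]
      rw [this, onPairFun_split h, hγδ]
      simp [split]
    · simp [onPairFun, h0, h1]

theorem continuous_onPairFun {Z : Type} [DecidableEq Z] (z₀ z₁ : Z) {γ : Cantor → Cantor}
    (hγ : Continuous γ) : Continuous (onPairFun z₀ z₁ γ) := by
  refine continuous_sigma fun z => ?_
  by_cases h0 : z = z₀
  · simpa [onPairFun, h0] using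
      (continuous_split z₀ z₁).comp' (hγ.comp' (continuous_cons false))
  · by_cases h1 : z = z₁
    · subst h1
      simpa [onPairFun, h0] using
        (continuous_split z₀ z).comp' (hγ.comp' (continuous_cons true))
    · simpa [onPairFun, h0, h1] using continuous_mk z

/-- The homeomorphism given by `onPairFun`. -/
def onPair {Z : Type} [DecidableEq Z] (z₀ z₁ : Z) (h : z₀ ≠ z₁) (γ : Cantor ≃ₜ Cantor) :
    CantorUnion Z ≃ₜ CantorUnion Z where
  toFun := onPairFun z₀ z₁ γ
  invFun := onPairFun z₀ z₁ γ.symm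
  left_inv := onPairFun_onPairFun h _ _ γ.symm_apply_apply
  right_inv := onPairFun_onPairFun h _ _ γ.apply_symm_apply
  continuous_toFun := continuous_onPairFun z₀ z₁ γ.continuous
  continuous_invFun := continuous_onPairFun z₀ z₁ γ.symm.continuous

/-! ## The generators of the first Grigorchuk group -/

/-- The rooted automorphism `a` of the binary tree `{0,1}*`. -/
def grigA : List Bool → List Bool
  | [] => []
  | x :: w => (!x) :: w

mutual

/-- The automorphism `b = (a, c)`. -/
def grigB : List Bool → List Bool
  | [] => []
  | false :: w => false :: grigA w
  | true :: w => true :: grigC w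

/-- The automorphism `c = (a, d)`. -/
def grigC : List Bool → List Bool
  | [] => []
  | false :: w => false :: grigA w
  | true :: w => true :: grigD w

/-- The automorphism `d = (1, b)`. -/
def grigD : List Bool → List Bool
  | [] => []
  | false :: w => false :: w
  | true :: w => true :: grigB w

end

theorem grigA_invol (w : List Bool) : grigA (grigA w) = w := by
  cases w <;> simp [grigA]

theorem grigA_length (w : List Bool) : (grigA w).length = w.length := by
  cases w <;> simp [grigA]

theorem grigBCD_invol (w : List Bool) :
    grigB (grigB w) = w ∧ grigC (grigC w) = w ∧ grigD (grigD w) = w := by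
  induction w with
  | nil => simp [grigB, grigC, grigD]
  | cons x w ih => cases x <;> simp [grigB, grigC, grigD, grigA_invol, ih]

theorem grigBCD_length (w : List Bool) :
    (grigB w).length = w.length ∧ (grigC w).length = w.length ∧
      (grigD w).length = w.length := by
  induction w with
  | nil => simp [grigB, grigC, grigD]
  | cons x w ih => cases x <;> simp [grigB, grigC, grigD, grigA_length, ih]

/-- The permutation of the `n`-th level induced by a length-preserving involution of `{0,1}*`. -/
def levelPerm (n : ℕ) (g : List Bool → List Bool) (hg : ∀ w, g (g w) = w)
    (hl : ∀ w, (g w).length = w.length) : Equiv.Perm (Level n) where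
  toFun w := ⟨g w, (hl w).trans w.2⟩
  invFun w := ⟨g w, (hl w).trans w.2⟩
  left_inv w := Subtype.ext (hg w)
  right_inv w := Subtype.ext (hg w)

/-- The permutation `a_n` of `X_n`. -/
def aPerm (n : ℕ) : Equiv.Perm (Level n) := levelPerm n grigA grigA_invol grigA_length

/-- The permutation `b_n` of `X_n`. -/
def bPerm (n : ℕ) : Equiv.Perm (Level n) :=
  levelPerm n grigB (fun w => (grigBCD_invol w).1) (fun w => (grigBCD_length w).1)

/-- The permutation `c_n` of `X_n`. -/
def cPerm (n : ℕ) : Equiv.Perm (Level n) :=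
  levelPerm n grigC (fun w => (grigBCD_invol w).2.1) (fun w => (grigBCD_length w).2.1)

/-- The permutation `d_n` of `X_n`. -/
def dPerm (n : ℕ) : Equiv.Perm (Level n) :=
  levelPerm n grigD (fun w => (grigBCD_invol w).2.2) (fun w => (grigBCD_length w).2.2)

/-! ## The group `W_n` -/

/-- The vertex `ρ_n = 1^n`. -/
def rho (n : ℕ) : Level n := ⟨List.replicate n true, List.length_replicate⟩

/-- The vertex `η_n = 1^(n-1) 0`. -/
def eta (n : ℕ) (hn : 1 ≤ n) : Level n :=
  ⟨List.replicate (n - 1) true ++ [false], by simp; omega⟩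

/-- The vertex `θ_n = a_n ρ_n = 0 1^(n-1)`. -/
def theta (n : ℕ) : Level n := aPerm n (rho n)

/-- The index set `Y_n = X_n × {1,2,3,4}`; the sheets `1, 2, 3, 4` are the elements
`0, 1, 2, 3` of `Fin 4`. -/
abbrev Sheets (n : ℕ) : Type := Level n × Fin 4

/-- Type 1: the diagonal action of a permutation of `X_n` on the four sheets. -/
def diagonal (n : ℕ) (g : Equiv.Perm (Level n)) :
    CantorUnion (Sheets n) ≃ₜ CantorUnion (Sheets n) :=
  permute (Equiv.prodCongr g (Equiv.refl (Fin 4)))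

/-- Type 2: a permutation `σ` of the four sheets, acting over the vertex `x` only. -/
def symOver (n : ℕ) (x : Level n) (σ : Equiv.Perm (Fin 4)) :
    CantorUnion (Sheets n) ≃ₜ CantorUnion (Sheets n) :=
  permute (Equiv.prodShear (Equiv.refl (Level n)) fun y => if y = x then σ else Equiv.refl (Fin 4))

/-- Type 3: the linking transposition `τ_n`. -/
def tau (n : ℕ) : CantorUnion (Sheets n) ≃ₜ CantorUnion (Sheets n) :=
  permute (Equiv.swap (rho n, 0) (theta n, 0))

/-- Type 4: `X₀` acting on the union of the second and the third copy over `ρ_n`. -/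
def thompsonX0 (n : ℕ) : CantorUnion (Sheets n) ≃ₜ CantorUnion (Sheets n) :=
  onPair (rho n, 1) (rho n, 2) (by simp) x0

/-- Type 4: `X₀` acting on the fourth copy over `ρ_n`. -/
def thompsonX1 (n : ℕ) : CantorUnion (Sheets n) ≃ₜ CantorUnion (Sheets n) :=
  onCopy (rho n, 3) x0

/-- The generating set `T_n`. -/
def generators (n : ℕ) (hn : 1 ≤ n) : Set (CantorUnion (Sheets n) ≃ₜ CantorUnion (Sheets n)) :=
  {diagonal n (aPerm n), diagonal n (bPerm n), diagonal n (cPerm n), diagonal n (dPerm n)} ∪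
    Set.range (symOver n (eta n hn)) ∪ {tau n} ∪ {thompsonX0 n, thompsonX1 n}

/-- The group `W_n` generated by `T_n`. -/
def groupW (n : ℕ) (hn : 1 ≤ n) : Subgroup (CantorUnion (Sheets n) ≃ₜ CantorUnion (Sheets n)) :=
  Subgroup.closure (generators n hn)

end ThompsonW

namespace ThompsonW

-- There are `4 * 2 ^ n = 2 ^ (n + 2)` copies of the Cantor set, so labelling them by the words of
-- length `n + 2` identifies their union with one Cantor set (`exists_homeomorph`). Conjugation by
-- this homeomorphism is shown to carry `W_n` onto `V`.
--
-- Every generator replaces prefixes on all sufficiently deep cones, so the image lies in `V`. For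
-- the converse, the Grigorchuk generators move the symmetric group over `η_n` to every vertex, and
-- together with `τ_n` they link the fibres, so `W_n` contains every permutation of the copies
-- (`perm_sheets_eq_top`). Conjugating `X_0^{(n)}` by these gives `X₀` on every ordered pair of
-- distinct copies. Such an element strips the first letter of a cone, using another copy as spare
-- room. By induction any two disjoint cones can be brought to two whole copies, whose swap is a
-- permutation of copies; hence `W_n` contains all swaps of disjoint cones (`exists_cone_swap`).
--
-- These swaps generate `V`: by transpositions of cylinders a sibling pair of the domain partition
-- is made to map to a sibling pair, both pairs are merged, and the number of pieces drops
-- (`mem_of_transpositions`). The generator `X_1^{(n)}` matters only for the inclusion into `V`.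

open Equiv

-- Transitivity on levels and the symmetric group on the copies

/-- A predicate on words that is stable under the four generators of the Grigorchuk group and
holds at `w` holds at the all-ones word of the same length. -/
theorem grig_reach_ones (w : List Bool) : ∀ (P : List Bool → Prop),
    (∀ u, P u → P (grigA u)) → (∀ u, P u → P (grigB u)) → (∀ u, P u → P (grigC u)) →
    (∀ u, P u → P (grigD u)) → P w → P (List.replicate w.length true) := by
  induction w with
  | nil => exact fun P _ _ _ _ h => h
  | cons x w ih =>
    intro P hA hB hC hD h
    have h1 : P (true :: w) := by
      cases x with
      | true => exact h
      | false => exact hA _ h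
    -- Self-similarity: on words `1u` the elements `aba`, `d`, `b`, `c` act on `u` as `a`, `b`, `c`,
    -- `d`.
    refine ih (fun u => P (true :: u)) (fun u hu => ?_) (fun u hu => ?_) (fun u hu => ?_)
      (fun u hu => ?_) h1
    · simpa [grigA, grigB] using hA _ (hB _ (hA _ hu))
    · simpa [grigD] using hD _ hu
    · simpa [grigB] using hB _ hu
    · simpa [grigC] using hC _ hu

theorem grigBCD_ones (n : ℕ) :
    grigB (List.replicate n true) = List.replicate n true ∧
    grigC (List.replicate n true) = List.replicate n true ∧
    grigD (List.replicate n true) = List.replicate n true := by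
  induction n with
  | zero => simp [grigB, grigC, grigD]
  | succ n ih => simp [List.replicate_succ, grigB, grigC, grigD, ih]

theorem levelPerm_reach_rho {n : ℕ} (P : Level n → Prop)
    (hP : ∀ g ∈ ({aPerm n, bPerm n, cPerm n, dPerm n} : Set (Perm (Level n))), ∀ x, P x → P (g x))
    (x : Level n) (hx : P x) : P (rho n) := by
  obtain ⟨w, rfl⟩ := x
  refine grig_reach_ones w (fun u => ∀ h : u.length = w.length, P ⟨u, h⟩) ?_ ?_ ?_ ?_
    (fun _ => hx) _
  · exact fun u hu h => hP (aPerm _) (by simp) ⟨u, (grigA_length u).symm.trans h⟩ (hu _)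
  · exact fun u hu h => hP (bPerm _) (by simp) ⟨u, (grigBCD_length u).1.symm.trans h⟩ (hu _)
  · exact fun u hu h => hP (cPerm _) (by simp) ⟨u, (grigBCD_length u).2.1.symm.trans h⟩ (hu _)
  · exact fun u hu h => hP (dPerm _) (by simp) ⟨u, (grigBCD_length u).2.2.symm.trans h⟩ (hu _)

theorem levelPerm_involutive {n : ℕ} {g : Perm (Level n)}
    (hg : g ∈ ({aPerm n, bPerm n, cPerm n, dPerm n} : Set (Perm (Level n)))) (x : Level n) :
    g (g x) = x := by
  rcases hg with rfl | rfl | rfl | rfl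
  · exact Subtype.ext (grigA_invol _)
  · exact Subtype.ext (grigBCD_invol _).1
  · exact Subtype.ext (grigBCD_invol _).2.1
  · exact Subtype.ext (grigBCD_invol _).2.2

/-- The Grigorchuk group acts transitively on each level. -/
theorem levelPerm_transitive {n : ℕ} (P : Level n → Prop)
    (hP : ∀ g ∈ ({aPerm n, bPerm n, cPerm n, dPerm n} : Set (Perm (Level n))), ∀ x, P x → P (g x))
    (x : Level n) (hx : P x) (y : Level n) : P y := by
  by_contra hy
  -- The generators are involutions, so the complement of an invariant set is invariant too; if both
  -- were nonempty, both would contain `ρ_n`.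
  refine levelPerm_reach_rho (fun x => ¬ P x) (fun g hg u hu h => hu ?_) y hy
    (levelPerm_reach_rho P hP x hx)
  simpa [levelPerm_involutive hg] using hP g hg _ h

/-- A group of permutations of the sheets that contains the diagonal Grigorchuk generators, the
symmetric group over `η_n` and the linking transposition is the full symmetric group. -/
theorem perm_sheets_eq_top {n : ℕ} (hn : 1 ≤ n) (S : Subgroup (Perm (Sheets n)))
    (hdiag : ∀ g ∈ ({aPerm n, bPerm n, cPerm n, dPerm n} : Set (Perm (Level n))),
      Equiv.prodCongr g (Equiv.refl (Fin 4)) ∈ S)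
    (hsym : ∀ σ : Perm (Fin 4), Equiv.prodShear (Equiv.refl (Level n))
      (fun y => if y = eta n hn then σ else Equiv.refl (Fin 4)) ∈ S)
    (htau : swap (rho n, (0 : Fin 4)) (theta n, 0) ∈ S) : S = ⊤ := by
  have hconj : ∀ g ∈ ({aPerm n, bPerm n, cPerm n, dPerm n} : Set (Perm (Level n))),
      ∀ (x y : Level n) (i j : Fin 4),
      swap (x, i) (y, j) ∈ S → swap (g x, i) (g y, j) ∈ S := by
    intro g hg x y i j h
    have := S.mul_mem (S.mul_mem (hdiag g hg) h) (S.inv_mem (hdiag g hg))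
    rwa [← Equiv.swap_apply_apply] at this
  have hfib : ∀ x : Level n, ∀ i j : Fin 4, swap (x, i) (x, j) ∈ S := by
    refine levelPerm_transitive _ (fun g hg x hx i j => hconj g hg _ _ _ _ (hx i j)) (eta n hn) ?_
    intro i j
    convert hsym (swap i j) using 1
    ext1 ⟨x, k⟩
    by_cases hx : x = eta n hn
    · subst hx
      simp only [Equiv.swap_apply_def, Equiv.prodShear_apply, Prod.mk.injEq, true_and]
      split_ifs <;> simp_all [Equiv.swap_apply_def]
    · simp [Equiv.swap_apply_def, hx]
  have hzero : ∀ x : Level n, swap (x, (0 : Fin 4)) (rho n, 0) ∈ S := by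
    refine levelPerm_transitive _ (fun g hg x hx => ?_) (rho n) (by rw [swap_self]; exact S.one_mem)
    have h := hconj g hg _ _ _ _ hx
    -- Conjugation also moves the base point `ρ_n`: `b`, `c`, `d` fix it, while `a` sends it to
    -- `θ_n`, which `τ_n` links back to `ρ_n`.
    rcases hg with rfl | rfl | rfl | rfl
    · exact SubmonoidClass.swap_mem_trans S h (by rw [swap_comm]; exact htau)
    · rwa [show bPerm n (rho n) = rho n from Subtype.ext (grigBCD_ones n).1] at h
    · rwa [show cPerm n (rho n) = rho n from Subtype.ext (grigBCD_ones n).2.1] at h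
    · rwa [show dPerm n (rho n) = rho n from Subtype.ext (grigBCD_ones n).2.2] at h
  have hall : ∀ p : Sheets n, swap p (rho n, 0) ∈ S := fun p =>
    SubmonoidClass.swap_mem_trans S (hfib p.1 p.2 0) (hzero p.1)
  have : Finite (Level n) := inferInstanceAs (Finite (List.Vector Bool n))
  rw [eq_top_iff, ← Equiv.Perm.closure_isSwap, Subgroup.closure_le]
  rintro _ ⟨p, q, -, rfl⟩
  exact SubmonoidClass.swap_mem_trans S (hall p) (by rw [swap_comm]; exact hall q)

-- Swaps of disjoint cones in a union of copies

/-- `s` exchanges `e ξ` and `f ξ` for all `ξ` and fixes all points off the ranges of `e`, `f`. -/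
structure IsPieceSwap {X : Type} [TopologicalSpace X] (s : X ≃ₜ X) (e f : Cantor → X) : Prop where
  left : ∀ ξ, s (e ξ) = f ξ
  right : ∀ ξ, s (f ξ) = e ξ
  off : ∀ x, (∀ ξ, e ξ ≠ x) → (∀ ξ, f ξ ≠ x) → s x = x

namespace IsPieceSwap

variable {X : Type} [TopologicalSpace X] {s : X ≃ₜ X} {e f : Cantor → X}

theorem symm (h : IsPieceSwap s e f) : IsPieceSwap s f e :=
  ⟨h.right, h.left, fun x he hf => h.off x hf he⟩

/-- Transport of a swap along a homeomorphism. -/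
theorem conj {Y : Type} [TopologicalSpace Y] (h : IsPieceSwap s e f) (g : X ≃ₜ Y) :
    IsPieceSwap ((g.symm.trans s).trans g) (g ∘ e) (g ∘ f) := by
  refine ⟨fun ξ => by simp [h.left], fun ξ => by simp [h.right], fun x he hf => ?_⟩
  simp only [Homeomorph.trans_apply]
  rw [h.off, g.apply_symm_apply]
  · rintro ξ h'
    exact he ξ (by simp [h'])
  · rintro ξ h'
    exact hf ξ (by simp [h'])

end IsPieceSwap

/-- `h` maps the copy `y` with letter `b` onto the copy `y`, the rest of `y` into
the copy `z`, and fixes all copies other than `y` and `z`. -/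
theorem exists_shorten {Z : Type} [DecidableEq Z] {K : Subgroup (CantorUnion Z ≃ₜ CantorUnion Z)}
    (hK : ∀ (y z : Z) (h : y ≠ z), onPair y z h x0 ∈ K) {y z : Z} (hyz : y ≠ z) (b : Bool) :
    ∃ h ∈ K, (∀ ξ, h ⟨y, cons b ξ⟩ = ⟨y, ξ⟩) ∧ (∀ ξ, h ⟨y, cons (!b) ξ⟩ = ⟨z, cons b ξ⟩) ∧
      ∀ x ξ, x ≠ y → x ≠ z → h ⟨x, ξ⟩ = ⟨x, ξ⟩ := by
  cases b with
  | false =>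
    -- With `y` as `0ℭ` and `z` as `1ℭ`, the rules `00 ↦ 0` and `01 ↦ 10` are the two claims.
    refine ⟨onPair y z hyz x0, hK _ _ _, fun ξ => ?_, fun ξ => ?_, fun x ξ h1 h2 => ?_⟩
    · change onPairFun y z x0Fun _ = _
      simp [onPairFun, x0Fun, split]
    · change onPairFun y z x0Fun _ = _
      simp [onPairFun, x0Fun, split]
    · change onPairFun y z x0Fun _ = _
      simp [onPairFun, h1, h2]
  | true =>
    -- Mirror case: now `y` is `1ℭ`, and the inverse of `X₀` has the rules `11 ↦ 1` and `10 ↦ 01`.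
    refine ⟨(onPair z y hyz.symm x0)⁻¹, K.inv_mem (hK _ _ _), fun ξ => ?_, fun ξ => ?_,
      fun x ξ h1 h2 => ?_⟩
    · change onPairFun z y x0Inv _ = _
      simp [onPairFun, x0Inv, split, hyz]
    · change onPairFun z y x0Inv _ = _
      simp [onPairFun, x0Inv, split, hyz]
    · change onPairFun z y x0Inv _ = _
      simp [onPairFun, h1, h2]

/-- The parametrization of the cone of all points of the copy `c.1` with prefix `c.2`. -/
def cone {Z : Type} (c : Z × List Bool) (ξ : Cantor) : CantorUnion Z := ⟨c.1, prepend c.2 ξ⟩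

/-- The spare copy `z` is chosen different from the copies of both cones. Stripping the first letter
of `p` then fixes `q` if `q` lies in another copy, shortens it if it shares copy and first letter
with `p`, and otherwise pushes it into `z` with its length unchanged. In the first copy `q` cannot
be everything, as it is disjoint from `p`. -/
theorem exists_shorten_left {Z : Type} [DecidableEq Z]
    {K : Subgroup (CantorUnion Z ≃ₜ CantorUnion Z)}
    (hK : ∀ (y z : Z) (h : y ≠ z), onPair y z h x0 ∈ K) (hZ : ∀ y z : Z, ∃ x, y ≠ x ∧ z ≠ x)
    {p q : Z × List Bool} (hpq : ∀ ξ ζ, cone p ξ ≠ cone q ζ) (hp : p.2 ≠ []) :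
    ∃ h ∈ K, ∃ p' q' : Z × List Bool, h ∘ cone p = cone p' ∧ h ∘ cone q = cone q' ∧
      p'.2.length < p.2.length ∧ q'.2.length ≤ q.2.length := by
  obtain ⟨y, w⟩ := p
  obtain ⟨y', w'⟩ := q
  obtain ⟨z, hz, hz'⟩ := hZ y y'
  cases w with
  | nil => exact absurd rfl hp
  | cons b t =>
    obtain ⟨h, hhK, h1, h2, h3⟩ := exists_shorten hK hz b
    refine ⟨h, hhK, (y, t), ?_⟩
    by_cases hy : y' = y
    · subst hy
      cases w' with
      | nil => exact absurd rfl (hpq (fun _ => false) (prepend (b :: t) fun _ => false))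
      | cons b' t' =>
        by_cases hb : b' = b
        · subst hb
          exact ⟨(y', t'), funext fun ξ => h1 _, funext fun ξ => h1 _, by simp, by simp⟩
        · obtain rfl : b' = !b := by cases b <;> cases b' <;> simp_all
          exact ⟨(z, b :: t'), funext fun ξ => h1 _, funext fun ξ => h2 _, by simp, by simp⟩
    · exact ⟨(y', w'), funext fun ξ => h1 _, funext fun ξ => h3 _ _ hy hz', by simp, by simp⟩

theorem exists_swap_of_conj {X : Type} [TopologicalSpace X] {K : Subgroup (X ≃ₜ X)}
    {h : X ≃ₜ X} (hh : h ∈ K) {e f : Cantor → X}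
    (hs : ∃ s ∈ K, IsPieceSwap s (h ∘ e) (h ∘ f)) : ∃ s ∈ K, IsPieceSwap s e f := by
  obtain ⟨s, hs, hsw⟩ := hs
  refine ⟨h⁻¹ * s * h, K.mul_mem (K.mul_mem (K.inv_mem hh) hs) hh, ?_⟩
  have := hsw.conj h.symm
  rwa [← Function.comp_assoc, ← Function.comp_assoc, h.symm_comp_self] at this

/-- A group containing all permutations of the copies and all `X₀` on pairs of copies contains the
swaps of any two disjoint cones. -/
theorem exists_cone_swap {Z : Type} [DecidableEq Z]
    {K : Subgroup (CantorUnion Z ≃ₜ CantorUnion Z)} (hperm : ∀ σ : Perm Z, permute σ ∈ K)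
    (hK : ∀ (y z : Z) (h : y ≠ z), onPair y z h x0 ∈ K) (hZ : ∀ y z : Z, ∃ x, y ≠ x ∧ z ≠ x)
    (p q : Z × List Bool) (hpq : ∀ ξ ζ, cone p ξ ≠ cone q ζ) :
    ∃ s ∈ K, IsPieceSwap s (cone p) (cone q) := by
  induction hk : p.2.length + q.2.length using Nat.strong_induction_on generalizing p q with
  | _ k ih =>
    -- The induction is on the total length of the two words: stripping a letter from a nonempty
    -- word lowers it, and the swap obtained is conjugated back.
    have step : ∀ p q : Z × List Bool, (∀ ξ ζ, cone p ξ ≠ cone q ζ) →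
        p.2.length + q.2.length = k → p.2 ≠ [] → ∃ s ∈ K, IsPieceSwap s (cone p) (cone q) := by
      intro p q hpq hk hp
      obtain ⟨h, hhK, p', q', h1, h2, h3, h4⟩ := exists_shorten_left hK hZ hpq hp
      refine exists_swap_of_conj hhK ?_
      rw [h1, h2]
      refine ih _ (by omega) p' q' (fun ξ ζ he => ?_) rfl
      rw [← h1, ← h2] at he
      exact hpq _ _ (h.injective he)
    by_cases hp : p.2 = []
    · by_cases hq : q.2 = []
      · obtain ⟨y, w⟩ := p
        obtain ⟨z, w'⟩ := q
        subst hp hq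
        have hyz : y ≠ z := by
          rintro rfl
          exact hpq (fun _ => false) _ rfl
        refine ⟨permute (swap y z), hperm _, fun ξ => ?_, fun ξ => ?_, fun x h1 h2 => ?_⟩
        · simp [permute, cone]
        · simp [permute, cone]
        · obtain ⟨x, ξ⟩ := x
          have hx : swap y z x = x := swap_apply_of_ne_of_ne
            (by rintro rfl; exact h1 ξ rfl) (by rintro rfl; exact h2 ξ rfl)
          simp [permute, hx]
      · obtain ⟨s, hs, hsw⟩ := step q p (fun ξ ζ h => hpq _ _ h.symm) (by omega) hq
        exact ⟨s, hs, hsw.symm⟩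
    · exact step p q hpq hk hp

-- Dyadic partition sets and generation of `V` by swaps

theorem IsDyadicPartition.exists_mem {A : Finset (List Bool)} (hA : IsDyadicPartition A)
    (ξ : Cantor) : ∃ w ∈ A, ∃ ζ, prepend w ζ = ξ := by
  have h : ξ ∈ ⋃ w ∈ A, cylinder w := by rw [hA.1]; trivial
  simpa [cylinder] using h

theorem IsDyadicPartition.eq_of_prepend_eq {A : Finset (List Bool)} (hA : IsDyadicPartition A)
    {u v : List Bool} (hu : u ∈ A) (hv : v ∈ A) {ξ ζ : Cantor} (h : prepend u ξ = prepend v ζ) :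
    u = v := by
  by_contra huv
  exact Set.disjoint_left.1 (hA.2 hu hv huv) ⟨ξ, rfl⟩ ⟨ζ, h.symm⟩

theorem isDyadicPartition_of {A : Finset (List Bool)} (h1 : ∀ ξ, ∃ w ∈ A, ∃ ζ, prepend w ζ = ξ)
    (h2 : ∀ u ∈ A, ∀ v ∈ A, ∀ ξ ζ, prepend u ξ = prepend v ζ → u = v) : IsDyadicPartition A := by
  refine ⟨Set.eq_univ_of_forall fun ξ => by simpa [cylinder] using h1 ξ, fun u hu v hv huv => ?_⟩
  refine Set.disjoint_left.2 ?_
  rintro _ ⟨ξ, rfl⟩ ⟨ζ, h⟩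
  exact huv (h2 u hu v hv ξ ζ h.symm)

/-- A dyadic partition set other than `{∅}` contains two siblings. -/
theorem IsDyadicPartition.exists_caret {A : Finset (List Bool)} (hA : IsDyadicPartition A) :
    A = {[]} ∨ ∃ p, ∀ b, p ++ [b] ∈ A := by
  obtain ⟨w₀, hw₀, -⟩ := hA.exists_mem fun _ => false
  obtain ⟨w, hw, hmax⟩ := A.exists_max_image List.length ⟨w₀, hw₀⟩
  rcases w.eq_nil_or_concat with rfl | ⟨p, b, rfl⟩
  · left
    refine Finset.eq_singleton_iff_unique_mem.2 ⟨hw, fun u hu => ?_⟩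
    exact List.length_eq_zero_iff.1 (Nat.le_zero.1 (hmax u hu))
  · right
    -- Let `pb` be a longest word of `A`. A word of `A` meeting the sibling cylinder is no longer
    -- than `pb`, hence a prefix of the sibling; a proper prefix would be a prefix of `p` and
    -- overlap the cylinder of `pb`.
    have hsib : p ++ [!b] ∈ A := by
      obtain ⟨u, hu, ζ, hζ⟩ := hA.exists_mem (prepend (p ++ [!b]) fun _ => false)
      have hul : u.length ≤ (p ++ [!b]).length := by simpa using hmax u hu
      obtain ⟨s, hs⟩ := exists_append hul hζ
      rcases s.eq_nil_or_concat with rfl | ⟨t, c, rfl⟩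
      · simpa [hs] using hu
      · rw [List.concat_eq_append, ← List.append_assoc] at hs
        obtain ⟨rfl, -⟩ := List.append_inj' hs rfl
        have := hA.eq_of_prepend_eq (ζ := fun _ => false)
          (ξ := prepend (t ++ [b]) fun _ => false) hu hw (by simp [← prepend_append])
        have := congrArg List.length this
        simp at this
    refine ⟨p, fun c => ?_⟩
    by_cases hc : c = b
    · simpa [hc] using hw
    · rwa [show c = !b by cases b <;> cases c <;> simp_all]

theorem IsDyadicPartition.image {A : Finset (List Bool)} (hA : IsDyadicPartition A)
    {γ : Cantor ≃ₜ Cantor} {φ : List Bool → List Bool}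
    (hφ : ∀ w ∈ A, ∀ ξ, γ (prepend w ξ) = prepend (φ w) ξ) : IsDyadicPartition (A.image φ) := by
  refine isDyadicPartition_of (fun ξ => ?_) ?_
  · obtain ⟨w, hw, ζ, hζ⟩ := hA.exists_mem (γ.symm ξ)
    exact ⟨φ w, Finset.mem_image_of_mem _ hw, ζ, by rw [← hφ w hw, hζ, γ.apply_symm_apply]⟩
  · intro u hu v hv ξ ζ h
    obtain ⟨u, hu', rfl⟩ := Finset.mem_image.1 hu
    obtain ⟨v, hv', rfl⟩ := Finset.mem_image.1 hv
    have h := (hφ u hu' ξ).trans (h.trans (hφ v hv' ζ).symm)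
    rw [hA.eq_of_prepend_eq hu' hv' (γ.injective h)]

theorem IsDyadicPartition.injOn {A : Finset (List Bool)} (hA : IsDyadicPartition A)
    {γ : Cantor ≃ₜ Cantor} {φ : List Bool → List Bool}
    (hφ : ∀ w ∈ A, ∀ ξ, γ (prepend w ξ) = prepend (φ w) ξ) : Set.InjOn φ A := by
  intro u hu v hv h
  refine hA.eq_of_prepend_eq (ξ := fun _ => false) (ζ := fun _ => false) hu hv (γ.injective ?_)
  rw [hφ u hu, hφ v hv, h]

theorem prepend_eq_append (p : List Bool) (ξ : Cantor) :
    prepend p ξ = prepend (p ++ [ξ 0]) (tail ξ) := by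
  rw [prepend_append]
  exact congrArg _ (cons_head_tail ξ).symm

/-- Merging two siblings of a dyadic partition set. -/
theorem IsDyadicPartition.merge {A : Finset (List Bool)} (hA : IsDyadicPartition A)
    {p : List Bool} (hp : ∀ b, p ++ [b] ∈ A) :
    IsDyadicPartition (insert p ((A.erase (p ++ [false])).erase (p ++ [true]))) := by
  have key : ∀ v ∈ A, ∀ ξ ζ, prepend p ξ = prepend v ζ → v = p ++ [ξ 0] := fun v hv ξ ζ h => by
    rw [prepend_eq_append] at h
    exact (hA.eq_of_prepend_eq (hp _) hv h).symm
  refine isDyadicPartition_of (fun ξ => ?_) ?_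
  · obtain ⟨w, hw, ζ, rfl⟩ := hA.exists_mem ξ
    by_cases h : ∃ b, w = p ++ [b]
    · obtain ⟨b, rfl⟩ := h
      exact ⟨p, by simp, cons b ζ, (prepend_append p [b] ζ).symm⟩
    · push Not at h
      exact ⟨w, by simp [hw, h], ζ, rfl⟩
  · intro u hu v hv ξ ζ h
    simp only [Finset.mem_insert, Finset.mem_erase] at hu hv
    rcases hu with rfl | ⟨hu1, hu0, hu⟩ <;> rcases hv with rfl | ⟨hv1, hv0, hv⟩
    · rfl
    · have := key v hv ξ ζ h
      cases hb : ξ 0 <;> simp_all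
    · have := key u hu ζ ξ h.symm
      cases hb : ζ 0 <;> simp_all
    · exact hA.eq_of_prepend_eq hu hv h

theorem IsDyadicPartition.notMem_of_caret {A : Finset (List Bool)} (hA : IsDyadicPartition A)
    {p : List Bool} (hp : ∀ b, p ++ [b] ∈ A) : p ∉ A := fun h => by
  have := hA.eq_of_prepend_eq h (hp false) (ξ := cons false fun _ => false)
    (ζ := fun _ => false) (prepend_append p [false] _).symm
  simpa using congrArg List.length this

theorem card_merge_siblings_lt {A : Finset (List Bool)}
    {p : List Bool} (hp : ∀ b, p ++ [b] ∈ A) :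
    (insert p ((A.erase (p ++ [false])).erase (p ++ [true]))).card < A.card := by
  have h1 : p ++ [true] ∈ A.erase (p ++ [false]) := by simp [hp]
  have h2 := Finset.card_erase_add_one h1
  have h3 := Finset.card_erase_add_one (hp false)
  have := Finset.card_insert_le p ((A.erase (p ++ [false])).erase (p ++ [true]))
  omega

/-- A subgroup that realizes all transpositions of dyadic partition sets contains all dyadic
homeomorphisms. -/
theorem mem_of_transpositions {H : Subgroup (Cantor ≃ₜ Cantor)}
    (hH : ∀ B : Finset (List Bool), IsDyadicPartition B → ∀ p ∈ B, ∀ q ∈ B,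
      ∃ h ∈ H, ∀ u ∈ B, ∀ ξ, h (prepend u ξ) = prepend (swap p q u) ξ)
    (A : Finset (List Bool)) (hA : IsDyadicPartition A) (γ : Cantor ≃ₜ Cantor)
    (φ : List Bool → List Bool) (hφ : ∀ w ∈ A, ∀ ξ, γ (prepend w ξ) = prepend (φ w) ξ) :
    γ ∈ H := by
  induction hk : A.card using Nat.strong_induction_on generalizing A γ φ with
  | _ k ih =>
    subst hk
    have hcard : (A.image φ).card = A.card := Finset.card_image_of_injOn (hA.injOn hφ)
    have hcaret : ∀ {B : Finset (List Bool)} {p : List Bool}, (∀ b, p ++ [b] ∈ B) →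
        1 < B.card := fun hp => Finset.one_lt_card.2 ⟨_, hp false, _, hp true, by simp⟩
    -- `A` and its image have equally many words, so either both are `{∅}` and `γ` is the identity,
    -- or both contain a sibling pair.
    rcases hA.exists_caret with rfl | ⟨p, hp⟩
    · rcases (hA.image hφ).exists_caret with h | ⟨q, hq⟩
      · have h0 : φ [] = [] := by simpa using h
        have : γ = 1 := by
          ext1 ξ
          have := hφ [] (by simp) ξ
          rwa [h0] at this
        rw [this]
        exact H.one_mem
      · have := hcaret hq
        simp at this
    · rcases (hA.image hφ).exists_caret with h | ⟨q, hq⟩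
      · have := hcaret hp
        simp [← hcard, h] at this
      have hmem : ∀ {ψ : List Bool → List Bool} (b : Bool), ψ (p ++ [b]) ∈ A.image ψ :=
        fun b => Finset.mem_image_of_mem _ (hp b)
      obtain ⟨h₀, hh₀, H₀⟩ := hH _ (hA.image hφ) _ (hmem false) _ (hq false)
      set φ₁ : List Bool → List Bool := fun w => swap (φ (p ++ [false])) (q ++ [false]) (φ w)
        with hφ₁_def
      have hφ₁ : ∀ w ∈ A, ∀ ξ, (h₀ * γ) (prepend w ξ) = prepend (φ₁ w) ξ := fun w hw ξ => by
        change h₀ (γ _) = _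
        rw [hφ w hw, H₀ _ (Finset.mem_image_of_mem _ hw)]
      have h10 : φ₁ (p ++ [false]) = q ++ [false] := swap_apply_left _ _
      have hq1 : q ++ [true] ∈ A.image φ₁ := by
        obtain ⟨w, hw, hwq⟩ := Finset.mem_image.1 (hq true)
        -- The first transposition may displace `q1`, namely when `p0` was sent there; then the word
        -- formerly sent to `q0` is now sent to `q1`.
        by_cases hw0 : φ (p ++ [false]) = q ++ [true]
        · obtain ⟨w', hw', hwq'⟩ := Finset.mem_image.1 (hq false)
          exact Finset.mem_image.2 ⟨w', hw', by simp [hφ₁_def, hwq', hw0]⟩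
        · refine Finset.mem_image.2 ⟨w, hw, ?_⟩
          rw [hφ₁_def]
          simp only [hwq]
          exact swap_apply_of_ne_of_ne (Ne.symm hw0) (by simp)
      obtain ⟨h₁, hh₁, H₁⟩ := hH _ (hA.image hφ₁) _ (hmem true) _ hq1
      set φ₂ : List Bool → List Bool := fun w => swap (φ₁ (p ++ [true])) (q ++ [true]) (φ₁ w)
        with hφ₂_def
      have hφ₂ : ∀ w ∈ A, ∀ ξ, (h₁ * (h₀ * γ)) (prepend w ξ) = prepend (φ₂ w) ξ :=
        fun w hw ξ => by
          change h₁ ((h₀ * γ) _) = _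
          rw [hφ₁ w hw, H₁ _ (Finset.mem_image_of_mem _ hw)]
      have h2 : ∀ b, φ₂ (p ++ [b]) = q ++ [b] := by
        intro b
        cases b with
        | true => exact swap_apply_left _ _
        | false =>
          simp only [hφ₂_def, h10]
          -- The second transposition does not disturb `p0 ↦ q0`: it moves only `q1` and the image
          -- of `p1`, and by injectivity the latter is not `q0`.
          refine swap_apply_of_ne_of_ne (fun h => ?_) (by simp)
          have := hA.injOn hφ₁ (hp false) (hp true) (h10.trans h)
          simp at this
      have hpA := hA.notMem_of_caret hp
      have hmain : h₁ * (h₀ * γ) ∈ H := by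
        refine ih _ (card_merge_siblings_lt hp) _ (hA.merge hp) _
          -- After the corrections `pb ↦ qb` for both letters `b`, so the map sends prefix `p` to
          -- `q`. Since `p ∉ A`, the values at the other words are unaffected.
          (Function.update φ₂ p q) ?_ rfl
        intro w hw ξ
        rcases Finset.mem_insert.1 hw with rfl | hw
        · rw [Function.update_self, prepend_eq_append, hφ₂ _ (hp _), h2, ← prepend_eq_append]
        · have hwA : w ∈ A := Finset.mem_of_mem_erase (Finset.mem_of_mem_erase hw)
          rw [Function.update_of_ne (by rintro rfl; exact hpA hwA), hφ₂ w hwA]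
      rwa [H.mul_mem_cancel_left hh₁, H.mul_mem_cancel_left hh₀] at hmain

/-- The swaps of `p0`, `q0` and of `p1`, `q1` combine to the swap of `p`, `q`. -/
theorem IsPieceSwap.mul {s₀ s₁ : Cantor ≃ₜ Cantor} {p q : List Bool}
    (hpq : ∀ ξ ζ, prepend p ξ ≠ prepend q ζ)
    (h₀ : IsPieceSwap s₀ (prepend (p ++ [false])) (prepend (q ++ [false])))
    (h₁ : IsPieceSwap s₁ (prepend (p ++ [true])) (prepend (q ++ [true]))) :
    IsPieceSwap (s₀ * s₁) (prepend p) (prepend q) := by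
  have hne : ∀ (r : List Bool) (b c : Bool) (ξ ζ : Cantor), b ≠ c →
      prepend (r ++ [b]) ξ ≠ prepend (r ++ [c]) ζ := by
    intro r b c ξ ζ hbc h
    rw [prepend_append, prepend_append] at h
    exact hbc (congrFun (prepend_injective r h) 0)
  have hne' : ∀ (b c : Bool) (ξ ζ : Cantor),
      prepend (p ++ [b]) ξ ≠ prepend (q ++ [c]) ζ := by
    intro b c ξ ζ h
    rw [prepend_append, prepend_append] at h
    exact hpq _ _ h
  -- The two swaps have disjoint supports: each fixes the cylinders exchanged by the other.
  have f0p : ∀ ξ, s₀ (prepend (p ++ [true]) ξ) = prepend (p ++ [true]) ξ := fun ξ =>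
    h₀.off _ (fun ζ => hne _ _ _ _ _ (by simp)) fun ζ => (hne' _ _ _ _).symm
  have f0q : ∀ ξ, s₀ (prepend (q ++ [true]) ξ) = prepend (q ++ [true]) ξ := fun ξ =>
    h₀.off _ (fun ζ => hne' _ _ _ _) fun ζ => hne _ _ _ _ _ (by simp)
  have f1p : ∀ ξ, s₁ (prepend (p ++ [false]) ξ) = prepend (p ++ [false]) ξ := fun ξ =>
    h₁.off _ (fun ζ => hne _ _ _ _ _ (by simp)) fun ζ => (hne' _ _ _ _).symm
  have f1q : ∀ ξ, s₁ (prepend (q ++ [false]) ξ) = prepend (q ++ [false]) ξ := fun ξ =>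
    h₁.off _ (fun ζ => hne' _ _ _ _) fun ζ => hne _ _ _ _ _ (by simp)
  refine ⟨fun ξ => ?_, fun ξ => ?_, fun x hp hq => ?_⟩
  · change s₀ (s₁ _) = _
    rw [prepend_eq_append p, prepend_eq_append q]
    cases ξ 0
    · rw [f1p, h₀.left]
    · rw [h₁.left, f0q]
  · change s₀ (s₁ _) = _
    rw [prepend_eq_append p, prepend_eq_append q]
    cases ξ 0
    · rw [f1q, h₀.right]
    · rw [h₁.right, f0p]
  · change s₀ (s₁ x) = _
    rw [h₁.off, h₀.off]
    all_goals
      intro ξ h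
      rw [prepend_append] at h
      first | exact hp _ h | exact hq _ h

/-- A subgroup containing the swaps of disjoint cylinders of depth at least `k` contains the swaps
of all disjoint cylinders. -/
theorem exists_swap_of_deep {H : Subgroup (Cantor ≃ₜ Cantor)} {k : ℕ}
    (hH : ∀ p q : List Bool, k ≤ p.length → k ≤ q.length → (∀ ξ ζ, prepend p ξ ≠ prepend q ζ) →
      ∃ s ∈ H, IsPieceSwap s (prepend p) (prepend q)) (p q : List Bool)
    (hpq : ∀ ξ ζ, prepend p ξ ≠ prepend q ζ) :
    ∃ s ∈ H, IsPieceSwap s (prepend p) (prepend q) := by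
  -- Here `j` bounds how many letters `p` and `q` lack to reach depth `k`; passing to the children
  -- lowers it by one.
  have key : ∀ (j : ℕ) (p q : List Bool), k ≤ p.length + j → k ≤ q.length + j →
      (∀ ξ ζ, prepend p ξ ≠ prepend q ζ) →
      ∃ s ∈ H, IsPieceSwap s (prepend p) (prepend q) := by
    intro j
    induction j with
    | zero => exact hH
    | succ j ih =>
      intro p q hp hq hpq
      have hb : ∀ b, ∃ s ∈ H, IsPieceSwap s (prepend (p ++ [b])) (prepend (q ++ [b])) := by
        refine fun b => ih _ _ (by simp; omega) (by simp; omega) fun ξ ζ h => ?_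
        rw [prepend_append, prepend_append] at h
        exact hpq _ _ h
      obtain ⟨s₀, hs₀, h₀⟩ := hb false
      obtain ⟨s₁, hs₁, h₁⟩ := hb true
      exact ⟨s₀ * s₁, H.mul_mem hs₀ hs₁, h₀.mul hpq h₁⟩
  exact key k p q (by omega) (by omega) hpq

/-- A group containing the swaps of any two disjoint cylinders contains Thompson's group `V`. -/
theorem thompsonV_le_of_swaps {H : Subgroup (Cantor ≃ₜ Cantor)}
    (hH : ∀ p q : List Bool, (∀ ξ ζ, prepend p ξ ≠ prepend q ζ) →
      ∃ s ∈ H, IsPieceSwap s (prepend p) (prepend q)) : thompsonV ≤ H := by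
  rintro γ ⟨A, B, hA, -, f, hf⟩
  refine mem_of_transpositions (fun B hB p hp q hq => ?_) A hA γ
    -- Only the values on `A` matter; outside `A` the default is arbitrary.
    (fun w => if hw : w ∈ A then f ⟨w, hw⟩ else w) fun w hw ξ => by simpa [hw] using hf ⟨w, hw⟩ ξ
  by_cases hpq : p = q
  · subst hpq
    exact ⟨1, H.one_mem, fun u _ ξ => by simp [swap_self]⟩
  · obtain ⟨s, hs, h⟩ := hH p q fun ξ ζ h => hpq (hB.eq_of_prepend_eq hp hq h)
    refine ⟨s, hs, fun u hu ξ => ?_⟩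
    by_cases hup : u = p
    · rw [hup, swap_apply_left, h.left]
    by_cases huq : u = q
    · rw [huq, swap_apply_right, h.right]
    rw [swap_apply_of_ne_of_ne hup huq]
    exact h.off _ (fun ζ h => hup (hB.eq_of_prepend_eq hp hu h).symm)
      fun ζ h => huq (hB.eq_of_prepend_eq hq hu h).symm

-- Transport to a single Cantor set

/-- A union of `2 ^ k` copies of the Cantor set, identified with the Cantor set. -/
theorem exists_homeomorph {Z : Type} {k : ℕ} (e : Z ≃ Level k) :
    ∃ Φ : CantorUnion Z ≃ₜ Cantor, ∀ z ξ, Φ ⟨z, ξ⟩ = prepend (e z) ξ := by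
  have : Finite (Level k) := inferInstanceAs (Finite (List.Vector Bool k))
  have : Finite Z := Finite.of_equiv _ e.symm
  let F : CantorUnion Z → Cantor := fun x => prepend (e x.1) x.2
  have hprep : ∀ w : List Bool, Continuous (prepend w) := by
    intro w
    induction w with
    | nil => exact continuous_id
    | cons b w ih => exact (continuous_cons b).comp ih
  have hF : Continuous F := continuous_sigma fun z => hprep (e z)
  have hbij : Function.Bijective F := by
    constructor
    · rintro ⟨z, ξ⟩ ⟨z', ξ'⟩ h
      change prepend (e z) ξ = prepend (e z') ξ' at h
      obtain ⟨s, hs⟩ := exists_append (by rw [(e z).2, (e z').2]) h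
      have hl := congrArg List.length hs
      rw [List.length_append, (e z).2, (e z').2] at hl
      obtain rfl : s = [] := List.length_eq_zero_iff.mp (by omega)
      obtain rfl : z' = z := e.injective (Subtype.ext (by simpa using hs))
      rw [prepend_injective _ h]
    · intro ξ
      obtain ⟨w, ζ, hw, rfl⟩ := exists_prepend k ξ
      exact ⟨⟨e.symm ⟨w, hw⟩, ζ⟩, by simp [F]⟩
  exact ⟨Continuous.homeoOfEquivCompactToT2 (f := Equiv.ofBijective F hbij) hF, fun _ _ => rfl⟩

/-- Conjugation by a homeomorphism. -/
def conjHomeo {X Y : Type} [TopologicalSpace X] [TopologicalSpace Y] (Φ : X ≃ₜ Y) :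
    (X ≃ₜ X) ≃* (Y ≃ₜ Y) where
  toFun γ := (Φ.symm.trans γ).trans Φ
  invFun γ := (Φ.trans γ).trans Φ.symm
  left_inv γ := by ext1 x; simp
  right_inv γ := by ext1 x; simp
  map_mul' γ δ := by
    ext1 x
    change Φ (γ (δ _)) = Φ (γ (Φ.symm (Φ (δ _))))
    simp

section

variable {Z : Type} {k : ℕ} {e : Z ≃ Level k} {Φ : CantorUnion Z ≃ₜ Cantor}

theorem comp_cone_of_prepend (hΦ : ∀ z ξ, Φ ⟨z, ξ⟩ = prepend (e z) ξ) (c : Z × List Bool) :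
    Φ ∘ cone c = prepend ((e c.1 : List Bool) ++ c.2) :=
  funext fun ξ => by simp [cone, hΦ, prepend_append]

/-- Conjugates of homeomorphisms that act by prefix replacement on all sufficiently deep cones are
dyadic. -/
theorem conjHomeo_mem_thompsonV (hΦ : ∀ z ξ, Φ ⟨z, ξ⟩ = prepend (e z) ξ)
    {γ : CantorUnion Z ≃ₜ CantorUnion Z} (N : ℕ)
    (hγ : ∀ c : Z × List Bool, N ≤ c.2.length → ∃ c', γ ∘ cone c = cone c') :
    conjHomeo Φ γ ∈ thompsonV := by
  -- The first `k` letters of a word name the copy, the remaining `N` or more give a deep enough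
  -- cone inside it.
  refine (isDyadic_iff _).2 ⟨N + k, fun w hw => ?_⟩
  have hk : (w.take k).length = k := by rw [List.length_take]; omega
  obtain ⟨c', hc'⟩ := hγ (e.symm ⟨w.take k, hk⟩, w.drop k) (by simp; omega)
  refine ⟨(e c'.1 : List Bool) ++ c'.2, fun ξ => ?_⟩
  have h := congrFun (comp_cone_of_prepend hΦ (e.symm ⟨w.take k, hk⟩, w.drop k)) ξ
  simp only [Equiv.apply_symm_apply, List.take_append_drop] at h
  change Φ (γ (Φ.symm _)) = _
  rw [← h, Function.comp_apply, Φ.symm_apply_apply]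
  exact (congrArg Φ (congrFun hc' ξ)).trans (congrFun (comp_cone_of_prepend hΦ c') ξ)

theorem conjHomeo_permute_mem (hΦ : ∀ z ξ, Φ ⟨z, ξ⟩ = prepend (e z) ξ) (σ : Perm Z) :
    conjHomeo Φ (permute σ) ∈ thompsonV :=
  conjHomeo_mem_thompsonV hΦ 0 fun c _ => ⟨(σ c.1, c.2), rfl⟩

/-- Two letters determine the branch of `X₀`. The output prefix is nonempty in every branch, so on a
pair of copies its first letter tells in which copy the image cone lies. -/
theorem exists_x0_prepend (w : List Bool) (hw : 2 ≤ w.length) :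
    ∃ b v, ∀ ξ, x0 (prepend w ξ) = prepend (b :: v) ξ := by
  obtain _ | ⟨b, _ | ⟨c, t⟩⟩ := w
  · simp at hw
  · simp at hw
  · cases b
    · cases c
      · exact ⟨false, t, fun ξ => rfl⟩
      · exact ⟨true, false :: t, fun ξ => rfl⟩
    · exact ⟨true, true :: c :: t, fun ξ => rfl⟩

theorem conjHomeo_onCopy_mem [DecidableEq Z] (hΦ : ∀ z ξ, Φ ⟨z, ξ⟩ = prepend (e z) ξ) (z : Z) :
    conjHomeo Φ (onCopy z x0) ∈ thompsonV := by
  refine conjHomeo_mem_thompsonV hΦ 2 fun c hc => ?_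
  by_cases h : c.1 = z
  · obtain ⟨b, v, hv⟩ := exists_x0_prepend c.2 hc
    exact ⟨(c.1, b :: v), funext fun ξ => by simp [onCopy, cone, h, hv]⟩
  · exact ⟨c, funext fun ξ => by simp [onCopy, cone, h]⟩

theorem conjHomeo_onPair_mem [DecidableEq Z] (hΦ : ∀ z ξ, Φ ⟨z, ξ⟩ = prepend (e z) ξ)
    {y z : Z} (hyz : y ≠ z) : conjHomeo Φ (onPair y z hyz x0) ∈ thompsonV := by
  -- Depth 1 suffices, as the choice of copy in the pair supplies the other letter read by `X₀`.
  refine conjHomeo_mem_thompsonV hΦ 1 fun c hc => ?_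
  have key : ∀ b, ∃ c' : Z × List Bool,
      ∀ ξ, split y z (x0 (cons b (prepend c.2 ξ))) = cone c' ξ := by
    intro b
    obtain ⟨b', v, hv⟩ := exists_x0_prepend (b :: c.2) (by simpa using hc)
    refine ⟨(if b' = true then z else y, v), fun ξ => ?_⟩
    rw [show cons b (prepend c.2 ξ) = prepend (b :: c.2) ξ from rfl, hv]
    cases b' <;> simp [split, cone, prepend]
  by_cases hy : c.1 = y
  · obtain ⟨c', hc'⟩ := key false
    refine ⟨c', funext fun ξ => ?_⟩
    rw [← hc']
    exact if_pos hy
  · by_cases hz : c.1 = z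
    · obtain ⟨c', hc'⟩ := key true
      refine ⟨c', funext fun ξ => ?_⟩
      rw [← hc']
      exact (if_neg hy).trans (if_pos hz)
    · exact ⟨c, funext fun ξ => (if_neg hy).trans (if_neg hz)⟩

/-- A group of homeomorphisms of `2 ^ k` copies of the Cantor set containing all permutations of
the copies and all `X₀` on pairs of copies contains all of Thompson's group `V`. -/
theorem thompsonV_le_map_conjHomeo [DecidableEq Z] (hΦ : ∀ z ξ, Φ ⟨z, ξ⟩ = prepend (e z) ξ)
    {K : Subgroup (CantorUnion Z ≃ₜ CantorUnion Z)} (hperm : ∀ σ : Perm Z, permute σ ∈ K)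
    (hK : ∀ (y z : Z) (h : y ≠ z), onPair y z h x0 ∈ K) (hZ : ∀ y z : Z, ∃ x, y ≠ x ∧ z ≠ x) :
    thompsonV ≤ K.map (conjHomeo Φ).toMonoidHom := by
  -- Cylinders of depth at least `k` lie in one copy and so correspond to cones; shallower ones are
  -- reached by subdividing.
  refine thompsonV_le_of_swaps (exists_swap_of_deep (k := k) fun p q hp hq hpq => ?_)
  have hcone : ∀ w : List Bool, k ≤ w.length → ∃ c : Z × List Bool, Φ ∘ cone c = prepend w := by
    intro w hw
    have hk : (w.take k).length = k := by rw [List.length_take]; omega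
    exact ⟨(e.symm ⟨w.take k, hk⟩, w.drop k), by simp [comp_cone_of_prepend hΦ]⟩
  obtain ⟨c, hc⟩ := hcone p hp
  obtain ⟨d, hd⟩ := hcone q hq
  obtain ⟨s, hs, hsw⟩ := exists_cone_swap hperm hK hZ c d fun ξ ζ h => by
    refine hpq ξ ζ ?_
    rw [← hc, ← hd, Function.comp_apply, h, Function.comp_apply]
  refine ⟨conjHomeo Φ s, Subgroup.mem_map_of_mem (conjHomeo Φ).toMonoidHom hs, ?_⟩
  rw [← hc, ← hd]
  exact hsw.conj Φ

end

-- The group `W_n` contains all permutations of copies and all `X₀` on pairs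

/-- The action on the copies of the Cantor set as a homomorphism. -/
def permuteHom (Z : Type) : Perm Z →* (CantorUnion Z ≃ₜ CantorUnion Z) where
  toFun := permute
  map_one' := rfl
  map_mul' _ _ := rfl

theorem permute_mul_onPair_mul_inv {Z : Type} [DecidableEq Z] (σ : Perm Z) {y z : Z} (h : y ≠ z)
    (γ : Cantor ≃ₜ Cantor) :
    permute σ * onPair y z h γ * (permute σ)⁻¹ =
      onPair (σ y) (σ z) (σ.injective.ne h) γ := by
  rw [mul_inv_eq_iff_eq_mul]
  ext1 ⟨x, ξ⟩
  change permute σ (onPairFun y z γ ⟨x, ξ⟩) = onPairFun (σ y) (σ z) γ ⟨σ x, ξ⟩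
  have hs : ∀ ζ, permute σ (split y z ζ) = split (σ y) (σ z) ζ := fun ζ => by
    unfold split
    split_ifs <;> rfl
  unfold onPairFun
  simp only [σ.injective.eq_iff]
  split_ifs
  · exact hs _
  · exact hs _
  · rfl

theorem permute_mem_groupW {n : ℕ} (hn : 1 ≤ n) (σ : Perm (Sheets n)) :
    permute σ ∈ groupW n hn := by
  have h := perm_sheets_eq_top hn ((groupW n hn).comap (permuteHom _)) ?_ ?_ ?_
  · have : σ ∈ (groupW n hn).comap (permuteHom _) := by rw [h]; trivial
    exact this
  · intro g hg
    refine Subgroup.subset_closure (Or.inl (Or.inl (Or.inl ?_)))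
    change diagonal n g ∈ _
    rcases hg with rfl | rfl | rfl | rfl <;> simp
  · exact fun σ => Subgroup.subset_closure (Or.inl (Or.inl (Or.inr ⟨σ, rfl⟩)))
  · exact Subgroup.subset_closure (Or.inl (Or.inr rfl))

theorem onPair_mem_groupW {n : ℕ} (hn : 1 ≤ n) (y z : Sheets n) (hyz : y ≠ z) :
    onPair y z hyz x0 ∈ groupW n hn := by
  obtain ⟨σ, rfl, rfl⟩ : ∃ σ : Perm (Sheets n), σ (rho n, 1) = y ∧ σ (rho n, 2) = z := by
    have h12 : ((rho n, 1) : Sheets n) ≠ (rho n, 2) := by simp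
    -- Double transitivity: the right factor brings the first point to `y`, the left one brings the
    -- current image of the second point to `z` and fixes `y`.
    refine ⟨swap (swap (rho n, 1) y (rho n, 2)) z * swap (rho n, 1) y, ?_, ?_⟩
    · rw [Perm.mul_apply, swap_apply_left]
      refine swap_apply_of_ne_of_ne (fun h => h12 ?_) hyz
      refine (swap (rho n, 1) y).injective ?_
      rwa [swap_apply_left]
    · rw [Perm.mul_apply, swap_apply_left]
  rw [← permute_mul_onPair_mul_inv σ (by simp)]
  have hσ := permute_mem_groupW hn σ
  exact mul_mem (mul_mem hσ (Subgroup.subset_closure (Or.inr (Or.inl rfl)))) (inv_mem hσ)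

/-- Four sheets over a vertex leave one that avoids any two given copies; this is the spare copy
needed for shortening cones. -/
theorem exists_sheet_ne {n : ℕ} (y z : Sheets n) : ∃ x, y ≠ x ∧ z ≠ x := by
  obtain ⟨i, h1, h2⟩ : ∃ i : Fin 4, y.2 ≠ i ∧ z.2 ≠ i := by
    generalize y.2 = a
    generalize z.2 = b
    revert a b
    decide
  exact ⟨(rho n, i), fun h => h1 (by rw [h]), fun h => h2 (by rw [h])⟩

theorem nonempty_sheets_equiv (n : ℕ) : Nonempty (Sheets n ≃ Level (n + 2)) := by
  have hc : ∀ k, Nat.card (Level k) = 2 ^ k := fun k => by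
    change Nat.card (List.Vector Bool k) = _
    rw [Nat.card_eq_fintype_card, card_vector, Fintype.card_bool]
  have (k : ℕ) : Finite (Level k) := inferInstanceAs (Finite (List.Vector Bool k))
  refine Finite.card_eq.1 ?_
  rw [Nat.card_prod, hc, hc, Nat.card_eq_fintype_card, Fintype.card_fin, pow_add]
  norm_num

end ThompsonW

theorem mainTheorem2 (n : ℕ) (hn : 1 ≤ n) :
    Nonempty (ThompsonW.groupW n hn ≃* ThompsonW.thompsonV) := by
  open ThompsonW in
  obtain ⟨e⟩ := nonempty_sheets_equiv n
  obtain ⟨Φ, hΦ⟩ := exists_homeomorph e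
  have h : (groupW n hn).map (conjHomeo Φ).toMonoidHom = thompsonV := by
    refine le_antisymm ?_ (thompsonV_le_map_conjHomeo hΦ (permute_mem_groupW hn)
      (onPair_mem_groupW hn) exists_sheet_ne)
    rw [Subgroup.map_le_iff_le_comap, groupW, Subgroup.closure_le]
    rintro γ (((h | ⟨σ, rfl⟩) | rfl) | rfl | rfl)
    · rcases h with rfl | rfl | rfl | rfl <;> exact conjHomeo_permute_mem hΦ _
    · exact conjHomeo_permute_mem hΦ _
    · exact conjHomeo_permute_mem hΦ _
    · exact conjHomeo_onPair_mem hΦ _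
    · exact conjHomeo_onCopy_mem hΦ _
  exact ⟨((conjHomeo Φ).subgroupMap _).trans (MulEquiv.subgroupCongr h)⟩
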